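/- Let $(F,g_F)$ be a connected smooth Riemannian manifold of dimension $n-1\ge 2$, let $I\subseteq\mathbb R$ be an open interval, and let $f:I\to(0,\infty)$ be smooth. Let $\overline M=I\times_f F$ be the corresponding Generalized Robertson--Walker (GRW) spacetime, i.e. the product manifold $I\times F$ with the Lorentzian metric $$\overline g=-dt^2+f(t)^2\,g_F ,$$ where $t$ is the coordinate on $I$ and $\partial_t=\partial/\partial t$. Let $M$ be a connected smooth manifold of dimension $k\ge 1$ and let $\psi:M\to\overline M$ be a spacelike immersion, i.e. a smooth immersion for which $g=\psi^*\overline g$ is a Riemannian metric on $M$. With $\overline\nabla$ the Levi-Civita connection of $\overline g$, let $\mathrm{II}(X,Y)=-(\overline\nabla_XY)^\perp$ be the second fundamental form of $\psi$ (note the sign convention), let $\overrightarrow H=\frac1k\operatorname{trace}_g(\mathrm{II})$ be the mean curvature vector field, and let $\tau=\pi_I\circ\psi:M\to I$ be the height function, where $\pi_I:I\times F\to I$ is the projection. (i) If $\overline g(\overrightarrow H,\partial_t)<0$ on all of $M$ and $f'\ge 0$ on $I$, then $\tau$ has no local minimum. The same conclusion holds if $\overline g(\overrightarrow H,\partial_t)\le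 0$ on $M$ and $f'>0$ on $I$. (ii) If $\overline g(\overrightarrow H,\partial_t)>0$ on all of $M$ and $f'\le 0$ on $I$, then $\tau$ has no local maximum. The same conclusion holds if $\overline g(\overrightarrow H,\partial_t)\ge 0$ on $M$ and $f'<0$ on $I$. Local extrema are understood in the non-strict sense. -/

import Mathlib

open scoped Manifold ContDiff

noncomputable section

namespace GRW

/-- The pullback `(u, v) ↦ B (A u) (A v)` of a bilinear form `B` under a linear map `A`. -/
def pullbackForm {V W : Type*} [NormedAddCommGroup V] [NormedSpace ℝ V]
    [NormedAddCommGroup W] [NormedSpace ℝ W] (B : V →L[ℝ] V →L[ℝ] ℝ) (A : W →L[ℝ] V) :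
    W →L[ℝ] W →L[ℝ] ℝ :=
  B.bilinearComp A A

section Ambient

variable {E : Type*} [NormedAddCommGroup E] [NormedSpace ℝ E]
  {H : Type*} [TopologicalSpace H] (I : ModelWithCorners ℝ E H)
  {N : Type*} [TopologicalSpace N] [ChartedSpace H N]

/-- A field of bilinear forms on the tangent spaces of `N`, i.e. a covariant 2-tensor field. -/
abbrev TwoTensor (N : Type*) [TopologicalSpace N] [ChartedSpace H N] :=
  ∀ x : N, TangentSpace I x →L[ℝ] TangentSpace I x →L[ℝ] ℝ

variable {I}

/-- The components `g_{ab}` of the metric `g` in the preferred chart around `q`, as a function of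
the coordinates `y`: the pullback of `g` under the inverse of the chart. -/
def chartMetric (g : TwoTensor I N) (q : N) (y : E) : E →L[ℝ] E →L[ℝ] ℝ :=
  pullbackForm (V := E) (W := E) (g ((extChartAt I q).symm y))
    (mfderiv 𝓘(ℝ, E) I (extChartAt I q).symm y)

/-- The Christoffel symbols of the first kind of `g` in the chart around `q`, at coordinates `y`:
the covector `w ↦ (1/2) (∂_u g(v, w) + ∂_v g(u, w) - ∂_w g(u, v))`. -/
def christoffelFirst (g : TwoTensor I N) (q : N) (y u v : E) : E →L[ℝ] ℝ :=
  (1 / 2 : ℝ) • (fderiv ℝ (chartMetric g q) y u v + fderiv ℝ (chartMetric g q) y v u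
    - ((fderiv ℝ (chartMetric g q) y).flip u).flip v)

/-- The Christoffel symbols `Γ(u, v)` (of the second kind) of the Levi-Civita connection of `g` in
the chart around `q`, at coordinates `y`: the first kind with its index raised by `g`, that is,
`g(Γ(u, v), w) = christoffelFirst g q y u v w` wherever `g` is nondegenerate. -/
def christoffel (g : TwoTensor I N) (q : N) (y u v : E) : E :=
  (chartMetric g q y).inverse (christoffelFirst g q y u v)

end Ambient

section Submanifold

variable {E : Type*} [NormedAddCommGroup E] [NormedSpace ℝ E]
  {H : Type*} [TopologicalSpace H] {I : ModelWithCorners ℝ E H}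
  {N : Type*} [TopologicalSpace N] [ChartedSpace H N]
  {M : Type*} [TopologicalSpace M]

/-- The covariant derivative at `p`, in the direction `v ∈ T_p M`, of a vector field `V` along
`ψ : M → N`, for the Levi-Civita connection of the metric `g` on `N`. In the chart around `ψ p` it
is `dV^a(v) + Γ^a_{bc} (dψ v)^b V^c`. -/
def covDerivAlong {k : ℕ} [ChartedSpace (EuclideanSpace ℝ (Fin k)) M]
    (g : TwoTensor I N) (ψ : M → N) (V : ∀ p : M, TangentSpace I (ψ p))
    (p : M) (v : TangentSpace (𝓡 k) p) : TangentSpace I (ψ p) :=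
  let φ : N → E := extChartAt I (ψ p)
  let Vc : M → E := fun p' => mfderiv I 𝓘(ℝ, E) φ (ψ p') (V p')
  let dV : E := mfderiv (𝓡 k) 𝓘(ℝ, E) Vc p v
  let u : E := mfderiv I 𝓘(ℝ, E) φ (ψ p) (mfderiv (𝓡 k) I ψ p v)
  -- the chart identifies `T_{ψ p} N` with `E`; transport the components back
  (mfderiv I 𝓘(ℝ, E) φ (ψ p)).inverse (dV + christoffel g (ψ p) (φ (ψ p)) u (Vc p))

/-- The metric induced on `M` by `ψ` from the metric `g` on `N`. -/
def inducedMetric (k : ℕ) [ChartedSpace (EuclideanSpace ℝ (Fin k)) M]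
    (g : TwoTensor I N) (ψ : M → N) : TwoTensor (𝓡 k) M :=
  fun p => pullbackForm (V := E) (W := EuclideanSpace ℝ (Fin k)) (g (ψ p)) (mfderiv (𝓡 k) I ψ p)

/-- The tangential component `w^⊤ ∈ T_p M` of a vector `w ∈ T_{ψ p} N`: the vector with
`(ψ^* g)(w^⊤, v) = g(w, dψ v)` for all `v ∈ T_p M`. -/
def tangentPart (k : ℕ) [ChartedSpace (EuclideanSpace ℝ (Fin k)) M]
    (g : TwoTensor I N) (ψ : M → N) (p : M) (w : TangentSpace I (ψ p)) :
    TangentSpace (𝓡 k) p :=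
  (inducedMetric k g ψ p).inverse ((g (ψ p) w).comp (mfderiv (𝓡 k) I ψ p))

/-- The normal component `w^⊥ = w - dψ(w^⊤)` of a vector `w ∈ T_{ψ p} N`. -/
def normalPart (k : ℕ) [ChartedSpace (EuclideanSpace ℝ (Fin k)) M]
    (g : TwoTensor I N) (ψ : M → N) (p : M) (w : TangentSpace I (ψ p)) :
    TangentSpace I (ψ p) :=
  w - mfderiv (𝓡 k) I ψ p (tangentPart k g ψ p w)

/-- The second fundamental form, with the sign convention of General Relativity:
`II(X, Y) = -(∇_X Y)^⊥` for vector fields `X`, `Y` on `M`, where `∇` is the Levi-Civita connection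
of the ambient metric `g`. -/
def secondFundamentalForm {k : ℕ} [ChartedSpace (EuclideanSpace ℝ (Fin k)) M]
    (g : TwoTensor I N) (ψ : M → N)
    (X Y : ∀ p : M, TangentSpace (𝓡 k) p) (p : M) : TangentSpace I (ψ p) :=
  -normalPart k g ψ p (covDerivAlong g ψ (fun p' => mfderiv (𝓡 k) I ψ p' (Y p')) p (X p))

/-- The `i`-th coordinate vector field of the preferred chart of `M` around `p₀` (used only on
the domain of that chart). -/
def coordField {k : ℕ} [ChartedSpace (EuclideanSpace ℝ (Fin k)) M]
    (p₀ : M) (i : Fin k) (p : M) : TangentSpace (𝓡 k) p :=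
  mfderiv 𝓘(ℝ, EuclideanSpace ℝ (Fin k)) (𝓡 k) (extChartAt (𝓡 k) p₀).symm
    (extChartAt (𝓡 k) p₀ p) (EuclideanSpace.single i (1 : ℝ))

/-- The Gram matrix `g_{ij}` of the induced metric at `p`, in the coordinate frame around `p`. -/
def gram (k : ℕ) [ChartedSpace (EuclideanSpace ℝ (Fin k)) M]
    (g : TwoTensor I N) (ψ : M → N) (p : M) : Matrix (Fin k) (Fin k) ℝ :=
  Matrix.of fun i j => inducedMetric k g ψ p (coordField p i p) (coordField p j p)

/-- The mean curvature vector `(1/k) trace II`, the trace being taken with respect to the induced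
metric: `(1/k) ∑_{i,j} g^{ij} II(∂_i, ∂_j)`. -/
def meanCurvature (k : ℕ) [ChartedSpace (EuclideanSpace ℝ (Fin k)) M]
    (g : TwoTensor I N) (ψ : M → N) (p : M) : TangentSpace I (ψ p) :=
  (1 / (k : ℝ)) • ∑ i : Fin k, ∑ j : Fin k,
    (gram k g ψ p)⁻¹ i j • secondFundamentalForm g ψ (coordField p i) (coordField p j) p

end Submanifold

section Spacetime

variable {m : ℕ} {F : Type*} [TopologicalSpace F] [ChartedSpace (EuclideanSpace ℝ (Fin m)) F]
  [IsManifold (𝓡 m) ∞ F]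

/-- The model of the product manifold `ℝ × F`. The spacetime `J ×_f F`, `J` an open interval, is
the open subset `J × F` of `ℝ × F`. -/
abbrev model (m : ℕ) := (𝓘(ℝ, ℝ)).prod (𝓡 m)

/-- The Lorentzian warped product metric `-dt² + f(t)² g_F`. -/
def metric (f : ℝ → ℝ)
    (gF : Bundle.ContMDiffRiemannianMetric (𝓡 m) ∞ (EuclideanSpace ℝ (Fin m))
      (fun x : F => TangentSpace (𝓡 m) x)) : TwoTensor (model m) (ℝ × F) :=
  fun z =>
    let dt : TangentSpace (model m) z →L[ℝ] ℝ :=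
      mfderiv (model m) 𝓘(ℝ, ℝ) (Prod.fst : ℝ × F → ℝ) z
    let dF : TangentSpace (model m) z →L[ℝ] TangentSpace (𝓡 m) z.2 :=
      mfderiv (model m) (𝓡 m) (Prod.snd : ℝ × F → F) z
    (f z.1) ^ 2 • pullbackForm (V := EuclideanSpace ℝ (Fin m))
        (W := ℝ × EuclideanSpace ℝ (Fin m)) (gF.inner z.2) dF
      - pullbackForm (V := ℝ) (W := ℝ × EuclideanSpace ℝ (Fin m)) (ContinuousLinearMap.mul ℝ ℝ) dt

/-- The coordinate vector field `∂_t` on `ℝ × F`. -/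
def partialT (z : ℝ × F) : TangentSpace (model m) z :=
  ((1 : ℝ), (0 : EuclideanSpace ℝ (Fin m)))

/-- `ψ` is a smooth immersion of `M` into `J ×_f F ⊆ ℝ × F` whose induced metric is Riemannian. -/
structure IsSpacelikeImmersion (k : ℕ) {M : Type*} [TopologicalSpace M]
    [ChartedSpace (EuclideanSpace ℝ (Fin k)) M] (J : Set ℝ) (f : ℝ → ℝ)
    (gF : Bundle.ContMDiffRiemannianMetric (𝓡 m) ∞ (EuclideanSpace ℝ (Fin m))
      (fun x : F => TangentSpace (𝓡 m) x)) (ψ : M → ℝ × F) : Prop where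
  mem : ∀ p, (ψ p).1 ∈ J
  contMDiff : ContMDiff (𝓡 k) (model m) ∞ ψ
  injective : ∀ p, Function.Injective (mfderiv (𝓡 k) (model m) ψ p)
  posDef : ∀ (p : M) (v : TangentSpace (𝓡 k) p), v ≠ 0 →
    0 < inducedMetric k (metric f gF) ψ p v v

/-- The height function `τ = π_J ∘ ψ`. -/
def height {M : Type*} (ψ : M → ℝ × F) : M → ℝ := fun p => (ψ p).1

end Spacetime

end GRW

end

/-
At a critical point of `τ` the field `∂_t` is normal to `M`, and the time component of the
Christoffel symbols of the warped product is `f f' g_F`; hence there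
`g(II(X, Y), ∂_t) = Hess τ (X, Y) + (f' / f) g(X, Y)`. Tracing with respect to the induced metric,
`g(H, ∂_t) = Δτ / k + f' / f`, where `Δτ` has the sign of a semidefinite Hessian at a local
extremum. So `g(H, ∂_t) ≥ f' / f` at a local minimum and `g(H, ∂_t) ≤ f' / f` at a local maximum.
-/

noncomputable section

namespace GRW

section SecondDerivative

theorem deriv_deriv_nonneg_of_isLocalMin {φ : ℝ → ℝ} {s : ℝ} (hφ : ContinuousAt φ s)
    (h : IsLocalMin φ s) : 0 ≤ deriv (deriv φ) s := by
  by_contra! hneg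
  have hmax : IsLocalMax φ s := isLocalMax_of_deriv_deriv_neg hneg h.deriv_eq_zero hφ
  have hconst : φ =ᶠ[nhds s] fun _ => φ s := by
    filter_upwards [h, hmax] with t h₁ h₂ using le_antisymm h₂ h₁
  have hderiv : deriv φ =ᶠ[nhds s] fun _ => 0 := by simpa using hconst.deriv
  simp [hderiv.deriv_eq] at hneg

variable {E : Type*} [NormedAddCommGroup E] [NormedSpace ℝ E]
  {G : Type*} [NormedAddCommGroup G] [NormedSpace ℝ G] {x : E}

theorem differentiableAt_fderiv {T : E → G} (hT : ContDiffAt ℝ 2 T x) :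
    DifferentiableAt ℝ (fderiv ℝ T) x :=
  (hT.fderiv_right (m := 1) (by norm_num)).differentiableAt one_ne_zero

theorem eventually_differentiableAt {T : E → G} (hT : ContDiffAt ℝ 2 T x) :
    ∀ᶠ y in nhds x, DifferentiableAt ℝ T y :=
  (hT.eventually (by simp)).mono fun _ hy => hy.differentiableAt two_ne_zero

theorem deriv_deriv_comp_line {T : E → G} (hT : ContDiffAt ℝ 2 T x) (v : E) :
    deriv (deriv fun s : ℝ => T (x + s • v)) 0 = fderiv ℝ (fderiv ℝ T) x v v := by
  have hline (s : ℝ) : HasDerivAt (fun s : ℝ => x + s • v) v s := by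
    simpa using ((hasDerivAt_id s).smul_const v).const_add x
  have htendsto : Filter.Tendsto (fun s : ℝ => x + s • v) (nhds 0) (nhds x) := by
    simpa [ContinuousAt] using (hline 0).continuousAt
  have hfirst : (deriv fun s : ℝ => T (x + s • v)) =ᶠ[nhds 0] fun s => fderiv ℝ T (x + s • v) v :=
    (htendsto.eventually (eventually_differentiableAt hT)).mono fun s hs =>
      (hs.hasFDerivAt.comp_hasDerivAt s (hline s)).deriv
  have hsecond : HasDerivAt (fun s : ℝ => fderiv ℝ T (x + s • v)) (fderiv ℝ (fderiv ℝ T) x v) 0 :=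
    (differentiableAt_fderiv hT).hasFDerivAt.comp_hasDerivAt_of_eq 0 (hline 0) (by simp)
  rw [hfirst.deriv_eq]
  simpa using (hsecond.clm_apply (hasDerivAt_const 0 v)).deriv

theorem fderiv_fderiv_nonneg_of_isLocalMin {T : E → ℝ} (hT : ContDiffAt ℝ 2 T x)
    (h : IsLocalMin T x) (v : E) : 0 ≤ fderiv ℝ (fderiv ℝ T) x v v := by
  have hline : ContinuousAt (fun s : ℝ => x + s • v) 0 := by fun_prop
  have hx : x + (0 : ℝ) • v = x := by simp
  rw [← deriv_deriv_comp_line hT]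
  exact deriv_deriv_nonneg_of_isLocalMin (hT.continuousAt.comp_of_eq hline hx)
    (IsLocalMin.comp_continuous (by rwa [hx]) hline)

theorem fderiv_fderiv_clm_comp {K : Type*} [NormedAddCommGroup K] [NormedSpace ℝ K] (L : G →L[ℝ] K)
    {T : E → G} (hT : ContDiffAt ℝ 2 T x) (v w : E) :
    fderiv ℝ (fderiv ℝ (L ∘ T)) x v w = L (fderiv ℝ (fderiv ℝ T) x v w) := by
  have hfirst : fderiv ℝ (L ∘ T) =ᶠ[nhds x] fun y => L.comp (fderiv ℝ T y) :=
    (eventually_differentiableAt hT).mono fun y hy => L.hasFDerivAt.comp y hy.hasFDerivAt |>.fderiv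
  rw [hfirst.fderiv_eq, fderiv_clm_comp (differentiableAt_const L) (differentiableAt_fderiv hT)]
  simp

end SecondDerivative

section Trace

variable {ι V : Type*} [AddCommGroup V] [Module ℝ V] {B : LinearMap.BilinForm ℝ V}

theorem bilin_sum_smul_sum_smul [Fintype ι] (B : LinearMap.BilinForm ℝ V) (c d : ι → ℝ)
    (e : ι → V) :
    B (∑ i, c i • e i) (∑ j, d j • e j) = ∑ i, ∑ j, c i * d j * B (e i) (e j) := by
  simp only [map_sum, map_smul, LinearMap.sum_apply, LinearMap.smul_apply, smul_eq_mul,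
    Finset.mul_sum, mul_assoc]
  rw [Finset.sum_comm]
  exact Finset.sum_congr rfl fun i _ => Finset.sum_congr rfl fun j _ => mul_left_comm _ _ _

theorem sum_mul_bilin_nonneg [Fintype ι] (hB : ∀ v, 0 ≤ B v v) {P : Matrix ι ι ℝ}
    (hP : P.PosSemidef) (e : ι → V) : 0 ≤ ∑ i, ∑ j, P i j * B (e i) (e j) := by
  obtain ⟨r, c, rfl⟩ := Matrix.posSemidef_iff_eq_sum_vecMulVec.1 hP
  calc 0 ≤ ∑ l, B (∑ i, c l i • e i) (∑ j, c l j • e j) := Finset.sum_nonneg fun l _ => hB _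
    _ = ∑ i, ∑ j, (∑ l, Matrix.vecMulVec (c l) (star (c l))) i j * B (e i) (e j) := by
      simp only [bilin_sum_smul_sum_smul, Matrix.sum_apply, Matrix.vecMulVec_apply, star_trivial,
        Finset.sum_mul, Finset.sum_comm (s := (Finset.univ : Finset (Fin r)))]

theorem posDef_of_linearIndependent [Finite ι] (hsymm : ∀ v w, B v w = B w v)
    (hpos : ∀ v, v ≠ 0 → 0 < B v v) {e : ι → V} (he : LinearIndependent ℝ e) :
    (Matrix.of fun i j => B (e i) (e j)).PosDef := by
  have := Fintype.ofFinite ι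
  refine .of_dotProduct_mulVec_pos (Matrix.ext fun i j => hsymm _ _) fun c hc => ?_
  calc 0 < B (∑ i, c i • e i) (∑ j, c j • e j) :=
        hpos _ fun h => hc (funext (Fintype.linearIndependent_iff.1 he c h))
    _ = star c ⬝ᵥ (Matrix.of fun i j => B (e i) (e j)).mulVec c := by
      simp only [bilin_sum_smul_sum_smul, star_trivial, dotProduct, Matrix.mulVec, Matrix.of_apply,
        Finset.mul_sum, mul_assoc, mul_comm (B _ _)]

open scoped Matrix in
theorem sum_inv_mul_self [Fintype ι] [DecidableEq ι] {P : Matrix ι ι ℝ} (hP : P.PosDef) :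
    ∑ i, ∑ j, P⁻¹ i j * P i j = Fintype.card ι := by
  have hsymm : Pᵀ = P := hP.isHermitian
  calc ∑ i, ∑ j, P⁻¹ i j * P i j = (P⁻¹ * Pᵀ).trace := Matrix.sum_hadamard_eq P⁻¹ P
    _ = Fintype.card ι := by
      rw [hsymm, Matrix.nonsing_inv_mul _ hP.det_pos.ne'.isUnit, Matrix.trace_one]

end Trace

theorem contMDiffOn_symmL {𝕜 : Type*} [NontriviallyNormedField 𝕜] {EB : Type*}
    [NormedAddCommGroup EB] [NormedSpace 𝕜 EB] {HB : Type*} [TopologicalSpace HB]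
    {IB : ModelWithCorners 𝕜 EB HB} {B : Type*} [TopologicalSpace B] [ChartedSpace HB B]
    {V : Type*} [NormedAddCommGroup V] [NormedSpace 𝕜 V] {W : B → Type*}
    [TopologicalSpace (Bundle.TotalSpace V W)] [∀ b, TopologicalSpace (W b)]
    [∀ b, AddCommGroup (W b)] [∀ b, Module 𝕜 (W b)] [FiberBundle V W] [VectorBundle 𝕜 V W]
    {n : ℕ∞ω} [ContMDiffVectorBundle n V W IB]
    (e : Bundle.Trivialization V (Bundle.TotalSpace.proj : Bundle.TotalSpace V W → B))
    [MemTrivializationAtlas e] (v : V) :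
    ContMDiffOn IB (IB.prod 𝓘(𝕜, V)) n (fun b => Bundle.TotalSpace.mk' V b (e.symmL 𝕜 b v))
      e.baseSet := by
  rw [e.contMDiffOn_section_baseSet_iff]
  refine contMDiffOn_const (c := v) |>.congr fun b hb => ?_
  rw [e.symmL_apply hb, e.apply_mk_symm hb]

section Chart

variable {E : Type*} [NormedAddCommGroup E] [NormedSpace ℝ E]
  {H : Type*} [TopologicalSpace H] {I : ModelWithCorners ℝ E H}
  {N : Type*} [TopologicalSpace N] [ChartedSpace H N]

theorem chartMetric_christoffel {g : TwoTensor I N} {q : N} {y : E}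
    (h : (chartMetric g q y).IsInvertible) (u v : E) :
    chartMetric g q y (christoffel g q y u v) = christoffelFirst g q y u v :=
  h.self_apply_inverse _

theorem isInvertible_of_injective_form {V : Type*} [NormedAddCommGroup V] [NormedSpace ℝ V]
    [FiniteDimensional ℝ V] {B : V →L[ℝ] V →L[ℝ] ℝ} (hB : Function.Injective B) :
    B.IsInvertible := by
  have hrank : Module.finrank ℝ V = Module.finrank ℝ (V →L[ℝ] ℝ) := by
    rw [← (LinearMap.toContinuousLinearMap (𝕜 := ℝ) (E := V) (F' := ℝ)).finrank_eq]
    exact Subspace.dual_finrank_eq.symm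
  exact ⟨(LinearEquiv.ofInjectiveOfFinrankEq (B : V →ₗ[ℝ] V →L[ℝ] ℝ) hB
    hrank).toContinuousLinearEquiv, rfl⟩

variable [I.Boundaryless]

theorem mfderiv_extChartAt_symm_self [IsManifold I 1 N] (q : N) :
    mfderiv 𝓘(ℝ, E) I (extChartAt I q).symm (extChartAt I q q) = ContinuousLinearMap.id ℝ E := by
  have h := mfderivWithin_range_extChartAt_symm (I := I) (x := q)
  rwa [I.range_eq_univ, mfderivWithin_univ] at h

theorem chartMetric_self [IsManifold I 1 N] (g : TwoTensor I N) (q : N) :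
    chartMetric g q (extChartAt I q q) = g q := by
  rw [chartMetric, mfderiv_extChartAt_symm_self, extChartAt_to_inv]
  rfl

theorem mdifferentiableAt_extChartAt_symm [IsManifold I 1 N] {q : N} {y : E}
    (hy : y ∈ (extChartAt I q).target) :
    MDifferentiableAt 𝓘(ℝ, E) I (extChartAt I q).symm y := by
  have h := mdifferentiableWithinAt_extChartAt_symm (I := I) hy
  rwa [I.range_eq_univ, mdifferentiableWithinAt_univ] at h

theorem contDiffOn_chartMetric_inner [IsManifold I ∞ N] [FiniteDimensional ℝ E]
    (g : Bundle.ContMDiffRiemannianMetric I ∞ E (fun x : N => TangentSpace I x)) (q : N) :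
    ContDiffOn ℝ ∞ (chartMetric (I := I) g.inner q) (extChartAt I q).target := by
  refine contDiffOn_clm_apply.2 fun v => contDiffOn_clm_apply.2 fun w => ?_
  have hsymm {y : E} (hy : y ∈ (extChartAt I q).target) :
      (extChartAt I q).symm y ∈ (chartAt H q).source := by
    simpa using (extChartAt I q).map_target hy
  have hcoeff : ContMDiffOn I 𝓘(ℝ, ℝ) ∞ (fun b : N => g.inner b
      ((trivializationAt E (TangentSpace I) q).symmL ℝ b v)
      ((trivializationAt E (TangentSpace I) q).symmL ℝ b w)) (chartAt H q).source := by
    intro b hb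
    have hsec := g.contMDiff.contMDiffAt.contMDiffWithinAt.clm_bundle_apply₂
      (contMDiffOn_symmL (IB := I) (trivializationAt E (TangentSpace I) q) v b hb)
      (contMDiffOn_symmL (IB := I) (trivializationAt E (TangentSpace I) q) w b hb)
    rwa [Bundle.contMDiffWithinAt_section] at hsec
  refine contMDiffOn_iff_contDiffOn.1
    ((hcoeff.comp (contMDiffOn_extChartAt_symm q) fun y hy => hsymm hy).congr fun y hy => ?_)
  have hframe := TangentBundle.symmL_trivializationAt (I := I) (𝕜 := ℝ) (hsymm hy)
  rw [I.range_eq_univ, mfderivWithin_univ, (extChartAt I q).right_inv hy] at hframe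
  simp only [chartMetric, pullbackForm, Function.comp_def, hframe]
  rfl

end Chart

section Forms

variable {V W X : Type*} [NormedAddCommGroup V] [NormedSpace ℝ V] [NormedAddCommGroup W]
  [NormedSpace ℝ W] [NormedAddCommGroup X] [NormedSpace ℝ X]

theorem differentiableAt_pullbackForm {Φ : X → V →L[ℝ] V →L[ℝ] ℝ} {x : X}
    (hΦ : DifferentiableAt ℝ Φ x) (A : W →L[ℝ] V) :
    DifferentiableAt ℝ (fun y => pullbackForm (Φ y) A) x := by
  have hcomp : (fun y => pullbackForm (Φ y) A) =
      fun y => (ContinuousLinearMap.precomp ℝ A).comp ((Φ y).comp A) := rfl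
  rw [hcomp]
  fun_prop

theorem hasFDerivAt_apply_apply {Φ : X → V →L[ℝ] W →L[ℝ] ℝ} {Φ' : X →L[ℝ] V →L[ℝ] W →L[ℝ] ℝ}
    {x : X} (hΦ : HasFDerivAt Φ Φ' x) (v : V) (w : W) :
    HasFDerivAt (fun y => Φ y v w) ((Φ'.flip v).flip w) x := by
  have h := (hΦ.clm_apply (hasFDerivAt_const v x)).clm_apply (hasFDerivAt_const w x)
  simpa using h

end Forms

section Spacetime

variable {m : ℕ} {F : Type*} [TopologicalSpace F] [ChartedSpace (EuclideanSpace ℝ (Fin m)) F]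

theorem extChartAt_model (q : ℝ × F) : ⇑(extChartAt (model m) q) =
    Prod.map id (extChartAt (𝓡 m) q.2) := by
  rw [extChartAt_prod]; rfl

theorem extChartAt_model_symm (q : ℝ × F) : ⇑(extChartAt (model m) q).symm =
    Prod.map id (extChartAt (𝓡 m) q.2).symm := by
  rw [extChartAt_prod]; rfl

theorem extChartAt_model_self (q : ℝ × F) :
    extChartAt (model m) q q = (q.1, extChartAt (𝓡 m) q.2 q.2) := by
  rw [extChartAt_model]; rfl

variable [IsManifold (𝓡 m) ∞ F] {f : ℝ → ℝ}
  {gF : Bundle.ContMDiffRiemannianMetric (𝓡 m) ∞ (EuclideanSpace ℝ (Fin m))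
    (fun x : F => TangentSpace (𝓡 m) x)}

theorem metric_apply (z : ℝ × F) (u v : TangentSpace (model m) z) :
    metric f gF z u v = f z.1 ^ 2 * gF.inner z.2 u.2 v.2 - u.1 * v.1 := by
  simp only [metric, pullbackForm, mfderiv_fst, mfderiv_snd]
  rfl

theorem metric_apply_partialT (z : ℝ × F) (u : TangentSpace (model m) z) :
    metric f gF z u (partialT z) = -u.1 := by
  have hzero : gF.inner z.2 u.2 (partialT z).2 = 0 := map_zero (gF.inner z.2 u.2)
  rw [metric_apply, hzero, partialT]
  ring

theorem metric_comm (z : ℝ × F) (u v : TangentSpace (model m) z) :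
    metric f gF z u v = metric f gF z v u := by
  have hsymm : gF.inner z.2 u.2 v.2 = gF.inner z.2 v.2 u.2 := gF.symm z.2 u.2 v.2
  rw [metric_apply, metric_apply]
  linear_combination f z.1 ^ 2 * hsymm

theorem injective_metric {z : ℝ × F} (hf : f z.1 ≠ 0) : Function.Injective (metric f gF z) := by
  refine (injective_iff_map_eq_zero _).2 fun u hu => ?_
  have hfst : u.1 = 0 := by
    have h := metric_apply_partialT (f := f) (gF := gF) z u
    rw [hu] at h
    exact neg_eq_zero.1 h.symm
  have hsnd : u.2 = 0 := by
    by_contra hne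
    have hpos := gF.pos z.2 u.2 hne
    have h := metric_apply (f := f) (gF := gF) z u u
    rw [hu, hfst] at h
    have : f z.1 ^ 2 * gF.inner z.2 u.2 u.2 = 0 := by simpa using h.symm
    exact hpos.ne' ((mul_eq_zero.1 this).resolve_left (pow_ne_zero 2 hf))
  exact Prod.ext hfst hsnd

theorem isInvertible_chartMetric_metric {q : ℝ × F} (hf : f q.1 ≠ 0) :
    (chartMetric (metric f gF) q (extChartAt (model m) q q)).IsInvertible := by
  refine isInvertible_of_injective_form ?_
  rw [chartMetric_self]
  exact injective_metric hf

theorem mfderiv_extChartAt_model_symm (q : ℝ × F) {y : ℝ × EuclideanSpace ℝ (Fin m)}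
    (hy : y.2 ∈ (extChartAt (𝓡 m) q.2).target) :
    mfderiv 𝓘(ℝ, ℝ × EuclideanSpace ℝ (Fin m)) (model m) (extChartAt (model m) q).symm y =
      (ContinuousLinearMap.id ℝ ℝ).prodMap
        (mfderiv 𝓘(ℝ, EuclideanSpace ℝ (Fin m)) (𝓡 m) (extChartAt (𝓡 m) q.2).symm y.2) := by
  have hfst := (ContinuousLinearMap.fst ℝ ℝ (EuclideanSpace ℝ (Fin m))).hasMFDerivAt (x := y)
  have hsnd := (mdifferentiableAt_extChartAt_symm hy).hasMFDerivAt.comp y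
    (ContinuousLinearMap.snd ℝ ℝ (EuclideanSpace ℝ (Fin m))).hasMFDerivAt
  rw [extChartAt_model_symm]
  exact (hfst.prodMk hsnd).mfderiv

theorem chartMetric_metric (q : ℝ × F) {y : ℝ × EuclideanSpace ℝ (Fin m)}
    (hy : y.2 ∈ (extChartAt (𝓡 m) q.2).target) :
    chartMetric (metric f gF) q y =
      f y.1 ^ 2 • pullbackForm (chartMetric gF.inner q.2 y.2)
          (ContinuousLinearMap.snd ℝ ℝ (EuclideanSpace ℝ (Fin m))) -
        pullbackForm (ContinuousLinearMap.mul ℝ ℝ)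
          (ContinuousLinearMap.fst ℝ ℝ (EuclideanSpace ℝ (Fin m))) := by
  refine ContinuousLinearMap.ext fun u => ContinuousLinearMap.ext fun v => ?_
  rw [chartMetric, mfderiv_extChartAt_model_symm q hy, extChartAt_model_symm]
  refine (metric_apply (f := f) (gF := gF) (Prod.map id (extChartAt (𝓡 m) q.2).symm y) _ _).trans ?_
  rfl

theorem eventually_chartMetric_metric (q : ℝ × F) :
    chartMetric (metric f gF) q =ᶠ[nhds (extChartAt (model m) q q)] fun y =>
      f y.1 ^ 2 • pullbackForm (chartMetric gF.inner q.2 y.2)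
          (ContinuousLinearMap.snd ℝ ℝ (EuclideanSpace ℝ (Fin m))) -
        pullbackForm (ContinuousLinearMap.mul ℝ ℝ)
          (ContinuousLinearMap.fst ℝ ℝ (EuclideanSpace ℝ (Fin m))) := by
  have hsnd : Filter.Tendsto Prod.snd (nhds (extChartAt (model m) q q))
      (nhds (extChartAt (𝓡 m) q.2 q.2)) := by
    rw [extChartAt_model]
    exact continuous_snd.continuousAt
  exact (hsnd.eventually (extChartAt_target_mem_nhds q.2)).mono fun y hy => chartMetric_metric q hy

theorem differentiableAt_chartMetric_inner (x : F) :
    DifferentiableAt ℝ (chartMetric (I := 𝓡 m) gF.inner x) (extChartAt (𝓡 m) x x) :=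
  ((contDiffOn_chartMetric_inner gF x).contDiffAt (extChartAt_target_mem_nhds x)).differentiableAt
    (by simp)

set_option maxSynthPendingDepth 3 in
theorem differentiableAt_chartMetric_metric {q : ℝ × F} (hf : DifferentiableAt ℝ f q.1) :
    DifferentiableAt ℝ (chartMetric (metric f gF) q) (extChartAt (model m) q q) := by
  refine DifferentiableAt.congr_of_eventuallyEq ?_ (eventually_chartMetric_metric q)
  have hinner := differentiableAt_chartMetric_inner (gF := gF) q.2
  have hpull := differentiableAt_pullbackForm
    (hinner.fun_comp' (q.1, extChartAt (𝓡 m) q.2 q.2) differentiableAt_snd)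
    (ContinuousLinearMap.snd ℝ ℝ (EuclideanSpace ℝ (Fin m)))
  have hwarp := hf.fun_comp' (q.1, extChartAt (𝓡 m) q.2 q.2) (f := Prod.fst) differentiableAt_fst
  rw [extChartAt_model_self]
  exact ((hwarp.fun_pow 2).fun_smul hpull).sub_const _

theorem fderiv_chartMetric_metric {q : ℝ × F} (hf : DifferentiableAt ℝ f q.1)
    (c u v : ℝ × EuclideanSpace ℝ (Fin m)) :
    fderiv ℝ (chartMetric (metric f gF) q) (extChartAt (model m) q q) c u v =
      2 * f q.1 * deriv f q.1 * c.1 * gF.inner q.2 u.2 v.2 + f q.1 ^ 2 *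
        fderiv ℝ (chartMetric (I := 𝓡 m) gF.inner q.2) (extChartAt (𝓡 m) q.2 q.2) c.2 u.2 v.2 := by
  have hcoeff : (fun y => chartMetric (metric f gF) q y u v) =ᶠ[nhds (extChartAt (model m) q q)]
      fun y => f y.1 ^ 2 * chartMetric (I := 𝓡 m) gF.inner q.2 y.2 u.2 v.2 - u.1 * v.1 :=
    (eventually_chartMetric_metric (f := f) (gF := gF) q).mono fun y hy =>
      congrArg (fun L => L u v) hy
  have happly := (hasFDerivAt_apply_apply
    (differentiableAt_chartMetric_metric (gF := gF) hf).hasFDerivAt u v).fderiv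
  rw [hcoeff.fderiv_eq, extChartAt_model_self] at happly
  have hinner := hasFDerivAt_apply_apply
    (differentiableAt_chartMetric_inner (gF := gF) q.2).hasFDerivAt u.2 v.2
  have hfib := hinner.comp (q.1, extChartAt (𝓡 m) q.2 q.2) (f := Prod.snd) hasFDerivAt_snd
  have hwarp := hf.hasDerivAt.comp_hasFDerivAt (q.1, extChartAt (𝓡 m) q.2 q.2)
    (ContinuousLinearMap.fst ℝ ℝ (EuclideanSpace ℝ (Fin m))).hasFDerivAt
  have hself : chartMetric (I := 𝓡 m) gF.inner q.2 (extChartAt (𝓡 m) q.2 q.2) u.2 v.2 =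
      gF.inner q.2 u.2 v.2 :=
    DFunLike.congr_fun (DFunLike.congr_fun (chartMetric_self (I := 𝓡 m) gF.inner q.2) u.2) v.2
  have hprod := (((hwarp.pow 2).mul hfib).sub_const (u.1 * v.1)).fderiv
  have heq := congrArg (fun L => L c) (happly.symm.trans hprod)
  rw [extChartAt_model_self]
  refine heq.trans ?_
  simp only [ContinuousLinearMap.coe_fst', Function.comp_apply, Nat.add_one_sub_one, pow_one,
    nsmul_eq_mul, Nat.cast_ofNat, add_apply, smul_apply, ContinuousLinearMap.comp_apply,
    ContinuousLinearMap.coe_snd', ContinuousLinearMap.flip_apply, smul_eq_mul]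
  linear_combination 2 * f q.1 * deriv f q.1 * c.1 * hself

theorem christoffel_metric_fst {q : ℝ × F} (hf : DifferentiableAt ℝ f q.1) (hf₀ : f q.1 ≠ 0)
    (u v : ℝ × EuclideanSpace ℝ (Fin m)) :
    (christoffel (metric f gF) q (extChartAt (model m) q q) u v).1 =
      f q.1 * deriv f q.1 * gF.inner q.2 u.2 v.2 := by
  have hlower := chartMetric_christoffel (isInvertible_chartMetric_metric (gF := gF) hf₀) u v
  rw [chartMetric_self] at hlower
  let Γ : ℝ × EuclideanSpace ℝ (Fin m) :=
    christoffel (metric f gF) q (extChartAt (model m) q q) u v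
  have htime : -Γ.1 =
      christoffelFirst (metric f gF) q (extChartAt (model m) q q) u v (partialT q) :=
    (metric_apply_partialT (f := f) (gF := gF) q Γ).symm.trans
      (DFunLike.congr_fun hlower (partialT q))
  have hfirst : christoffelFirst (metric f gF) q (extChartAt (model m) q q) u v (partialT q) =
      -(f q.1 * deriv f q.1 * gF.inner q.2 u.2 v.2) := by
    have hzero (w : EuclideanSpace ℝ (Fin m)) :
        gF.inner q.2 w (0 : EuclideanSpace ℝ (Fin m)) = 0 := map_zero (gF.inner q.2 w)
    simp only [christoffelFirst, partialT, smul_apply, sub_apply, add_apply,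
      fderiv_chartMetric_metric hf, hzero, map_zero, ContinuousLinearMap.flip_apply, smul_eq_mul,
      zero_apply]
    ring
  exact neg_injective (htime.trans hfirst)

end Spacetime

section Submanifold

variable {E : Type*} [NormedAddCommGroup E] [NormedSpace ℝ E]
  {H : Type*} [TopologicalSpace H] {I : ModelWithCorners ℝ E H}
  {N : Type*} [TopologicalSpace N] [ChartedSpace H N]
  {k : ℕ} {M : Type*} [TopologicalSpace M] [ChartedSpace (EuclideanSpace ℝ (Fin k)) M]
  {ψ : M → N} {p : M}

variable (I) in
/-- The second derivative at `p` of `ψ : M → N`, read in the preferred charts around `p` and `ψ p`.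
It depends on these charts, except where `mfderiv ψ p` vanishes; for a critical point of a real
function it is the Hessian. -/
def chartHessian (ψ : M → N) (p : M) :
    EuclideanSpace ℝ (Fin k) →L[ℝ] EuclideanSpace ℝ (Fin k) →L[ℝ] E :=
  fderiv ℝ (fderiv ℝ (writtenInExtChartAt (𝓡 k) I p ψ)) (extChartAt (𝓡 k) p p)

theorem contDiffAt_writtenInExtChartAt {n : ℕ∞ω} (hψ : ContMDiffAt (𝓡 k) I n ψ p) :
    ContDiffAt ℝ n (writtenInExtChartAt (𝓡 k) I p ψ) (extChartAt (𝓡 k) p p) := by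
  have h := (contMDiffAt_iff.1 hψ).2
  rwa [ModelWithCorners.range_eq_univ, contDiffWithinAt_univ] at h

section RealFunction

variable {τ : M → ℝ}

theorem writtenInExtChartAt_real (τ : M → ℝ) (p : M) :
    writtenInExtChartAt (𝓡 k) 𝓘(ℝ, ℝ) p τ = τ ∘ (extChartAt (𝓡 k) p).symm := rfl

theorem isLocalMin_writtenInExtChartAt (h : IsLocalMin τ p) :
    IsLocalMin (writtenInExtChartAt (𝓡 k) 𝓘(ℝ, ℝ) p τ) (extChartAt (𝓡 k) p p) := by
  rw [writtenInExtChartAt_real]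
  refine IsLocalMin.comp_continuous ?_ (continuousAt_extChartAt_symm p)
  rwa [extChartAt_to_inv]

theorem mfderiv_eq_zero_of_isLocalMin (h : IsLocalMin τ p) : mfderiv (𝓡 k) 𝓘(ℝ, ℝ) τ p = 0 := by
  by_cases hτ : MDifferentiableAt (𝓡 k) 𝓘(ℝ, ℝ) τ p
  · rw [hτ.mfderiv, ModelWithCorners.range_eq_univ, fderivWithin_univ]
    exact (isLocalMin_writtenInExtChartAt h).fderiv_eq_zero
  · exact mfderiv_zero_of_not_mdifferentiableAt hτ

theorem mfderiv_eq_zero_of_isLocalMax (h : IsLocalMax τ p) : mfderiv (𝓡 k) 𝓘(ℝ, ℝ) τ p = 0 := by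
  have hneg := mfderiv_eq_zero_of_isLocalMin (k := k) h.neg
  exact neg_eq_zero.1 (mfderiv_neg.symm.trans hneg)

theorem chartHessian_nonneg_of_isLocalMin (hτ : ContMDiffAt (𝓡 k) 𝓘(ℝ, ℝ) 2 τ p)
    (h : IsLocalMin τ p) (v : EuclideanSpace ℝ (Fin k)) : 0 ≤ chartHessian 𝓘(ℝ, ℝ) τ p v v :=
  fderiv_fderiv_nonneg_of_isLocalMin (contDiffAt_writtenInExtChartAt hτ)
    (isLocalMin_writtenInExtChartAt h) v

theorem chartHessian_neg (τ : M → ℝ) (p : M) :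
    chartHessian (k := k) 𝓘(ℝ, ℝ) (fun x => -τ x) p = -chartHessian 𝓘(ℝ, ℝ) τ p := by
  have hwritten : fderiv ℝ (writtenInExtChartAt (𝓡 k) 𝓘(ℝ, ℝ) p (fun x => -τ x)) =
      fun y => -fderiv ℝ (writtenInExtChartAt (𝓡 k) 𝓘(ℝ, ℝ) p τ) y :=
    funext fun y => fderiv_neg
  rw [chartHessian, hwritten, fderiv_fun_neg]
  rfl

theorem chartHessian_nonpos_of_isLocalMax (hτ : ContMDiffAt (𝓡 k) 𝓘(ℝ, ℝ) 2 τ p)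
    (h : IsLocalMax τ p) (v : EuclideanSpace ℝ (Fin k)) : chartHessian 𝓘(ℝ, ℝ) τ p v v ≤ 0 := by
  have hneg := chartHessian_nonneg_of_isLocalMin hτ.neg h.neg v
  rw [chartHessian_neg] at hneg
  exact neg_nonneg.1 hneg

end RealFunction

theorem metric_normalPart_of_orthogonal {g : TwoTensor I N} {ν : TangentSpace I (ψ p)}
    (hν : ∀ v : TangentSpace (𝓡 k) p, g (ψ p) (mfderiv (𝓡 k) I ψ p v) ν = 0)
    (w : TangentSpace I (ψ p)) : g (ψ p) (normalPart k g ψ p w) ν = g (ψ p) w ν := by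
  have hsub := map_sub (g (ψ p)) w (mfderiv (𝓡 k) I ψ p (tangentPart k g ψ p w))
  have happly := DFunLike.congr_fun hsub ν
  refine happly.trans ?_
  exact (congrArg (g (ψ p) w ν - ·) (hν _)).trans (sub_zero _)

theorem coordField_self [IsManifold (𝓡 k) 1 M] (p : M) (i : Fin k) :
    (coordField p i p : EuclideanSpace ℝ (Fin k)) = EuclideanSpace.single i 1 := by
  rw [coordField, mfderiv_extChartAt_symm_self]
  rfl

theorem gram_apply [IsManifold (𝓡 k) 1 M] (g : TwoTensor I N) (ψ : M → N) (p : M) (i j : Fin k) :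
    gram k g ψ p i j =
      inducedMetric k g ψ p (EuclideanSpace.single i 1 : EuclideanSpace ℝ (Fin k))
        (EuclideanSpace.single j 1 : EuclideanSpace ℝ (Fin k)) := by
  rw [gram, Matrix.of_apply, coordField_self, coordField_self]

theorem posDef_gram [IsManifold (𝓡 k) 1 M] {g : TwoTensor I N}
    (hsymm : ∀ u v, g (ψ p) u v = g (ψ p) v u)
    (hpos : ∀ v : TangentSpace (𝓡 k) p, v ≠ 0 → 0 < inducedMetric k g ψ p v v) :
    (gram k g ψ p).PosDef := by
  let B : EuclideanSpace ℝ (Fin k) →L[ℝ] EuclideanSpace ℝ (Fin k) →L[ℝ] ℝ := inducedMetric k g ψ p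
  have hgram : gram k g ψ p = Matrix.of fun i j =>
      B.toBilinForm (EuclideanSpace.basisFun (Fin k) ℝ i)
        (EuclideanSpace.basisFun (Fin k) ℝ j) := by
    ext i j
    rw [gram_apply, Matrix.of_apply, EuclideanSpace.basisFun_apply, EuclideanSpace.basisFun_apply]
    rfl
  rw [hgram]
  exact posDef_of_linearIndependent (fun v w => hsymm _ _) hpos
    (EuclideanSpace.basisFun (Fin k) ℝ).toBasis.linearIndependent

theorem apply_meanCurvature (g : TwoTensor I N) (ψ : M → N) (p : M) (ν : TangentSpace I (ψ p)) :
    g (ψ p) (meanCurvature k g ψ p) ν = (1 / (k : ℝ)) * ∑ i, ∑ j, (gram k g ψ p)⁻¹ i j *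
      g (ψ p) (secondFundamentalForm g ψ (coordField p i) (coordField p j) p) ν := by
  let L : E →ₗ[ℝ] ℝ := (g (ψ p)).toBilinForm.flip ν
  let S : Fin k → Fin k → E := fun i j =>
    secondFundamentalForm g ψ (coordField p i) (coordField p j) p
  change L ((1 / (k : ℝ)) • ∑ i, ∑ j, (gram k g ψ p)⁻¹ i j • S i j) = _
  simp only [map_smul, map_sum, smul_eq_mul]
  rfl

variable [IsManifold I 1 N] [IsManifold (𝓡 k) 1 M]

theorem fderiv_writtenInExtChartAt {y : EuclideanSpace ℝ (Fin k)}
    (hψ : MDifferentiableAt (𝓡 k) I ψ ((extChartAt (𝓡 k) p).symm y))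
    (hy : y ∈ (extChartAt (𝓡 k) p).target)
    (hψy : ψ ((extChartAt (𝓡 k) p).symm y) ∈ (chartAt H (ψ p)).source) :
    fderiv ℝ (writtenInExtChartAt (𝓡 k) I p ψ) y =
      (mfderiv I 𝓘(ℝ, E) (extChartAt I (ψ p)) (ψ ((extChartAt (𝓡 k) p).symm y)) : E →L[ℝ] E).comp
        ((mfderiv (𝓡 k) I ψ ((extChartAt (𝓡 k) p).symm y) :
          EuclideanSpace ℝ (Fin k) →L[ℝ] E).comp
        (mfderiv 𝓘(ℝ, EuclideanSpace ℝ (Fin k)) (𝓡 k) (extChartAt (𝓡 k) p).symm y :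
          EuclideanSpace ℝ (Fin k) →L[ℝ] EuclideanSpace ℝ (Fin k))) := by
  have hinner := hψ.hasMFDerivAt.comp y (mdifferentiableAt_extChartAt_symm hy).hasMFDerivAt
  have houter := (mdifferentiableAt_extChartAt (I := I) hψy).hasMFDerivAt
  refine HasFDerivAt.fderiv ?_
  exact hasMFDerivAt_iff_hasFDerivAt.1 (houter.comp y hinner)

theorem eventually_mfderiv_coordField (hψ : ContMDiff (𝓡 k) I 1 ψ) (p : M) (j : Fin k) :
    (fun p' => (mfderiv I 𝓘(ℝ, E) (extChartAt I (ψ p)) (ψ p')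
      (mfderiv (𝓡 k) I ψ p' (coordField p j p')) : E)) =ᶠ[nhds p]
    (fun y => fderiv ℝ (writtenInExtChartAt (𝓡 k) I p ψ) y (EuclideanSpace.single j 1)) ∘
      extChartAt (𝓡 k) p := by
  have hsource : ∀ᶠ p' in nhds p, ψ p' ∈ (chartAt H (ψ p)).source :=
    hψ.continuous.continuousAt.eventually (chart_source_mem_nhds H (ψ p))
  filter_upwards [hsource, extChartAt_source_mem_nhds (I := 𝓡 k) p] with p' hψp' hp'
  have hinv := (extChartAt (𝓡 k) p).left_inv hp'
  have hchain := fderiv_writtenInExtChartAt (hψ.mdifferentiableAt one_ne_zero)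
    ((extChartAt (𝓡 k) p).map_source hp') (by rwa [hinv])
  rw [hinv] at hchain
  simp only [Function.comp_apply, hchain]
  rfl

theorem mfderiv_mfderiv_coordField (hψ : ContMDiff (𝓡 k) I 2 ψ) (p : M) (j : Fin k)
    (v : TangentSpace (𝓡 k) p) :
    mfderiv (𝓡 k) 𝓘(ℝ, E) (fun p' => (mfderiv I 𝓘(ℝ, E) (extChartAt I (ψ p)) (ψ p')
      (mfderiv (𝓡 k) I ψ p' (coordField p j p')) : E)) p v =
    chartHessian I ψ p v (EuclideanSpace.single j 1) := by
  have hchart := (mdifferentiableAt_extChartAt (I := 𝓡 k) (mem_chart_source _ p)).hasMFDerivAt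
  rw [mfderiv_extChartAt_self] at hchart
  have hsecond := (differentiableAt_fderiv (contDiffAt_writtenInExtChartAt (hψ p))).hasFDerivAt
  have happly := (ContinuousLinearMap.apply ℝ E
    (EuclideanSpace.single j (1 : ℝ) : EuclideanSpace ℝ (Fin k))).hasFDerivAt.comp _ hsecond
  rw [(eventually_mfderiv_coordField (hψ.of_le one_le_two) p j).mfderiv_eq]
  exact DFunLike.congr_fun (happly.hasMFDerivAt.comp p hchart).mfderiv v

theorem covDerivAlong_coordField (g : TwoTensor I N) (hψ : ContMDiff (𝓡 k) I 2 ψ) (p : M)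
    (v : TangentSpace (𝓡 k) p) (j : Fin k) :
    (covDerivAlong g ψ (fun p' => mfderiv (𝓡 k) I ψ p' (coordField p j p')) p v : E) =
      chartHessian I ψ p v (EuclideanSpace.single j 1) +
        christoffel g (ψ p) (extChartAt I (ψ p) (ψ p)) (mfderiv (𝓡 k) I ψ p v)
          (mfderiv (𝓡 k) I ψ p (EuclideanSpace.single j 1 : EuclideanSpace ℝ (Fin k))) := by
  let A : E →L[ℝ] E := mfderiv I 𝓘(ℝ, E) (extChartAt I (ψ p)) (ψ p)
  have hA : A = ContinuousLinearMap.id ℝ E := mfderiv_extChartAt_self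
  let X : E := mfderiv (𝓡 k) I ψ p (coordField p j p)
  have hX : X = mfderiv (𝓡 k) I ψ p (EuclideanSpace.single j 1 : EuclideanSpace ℝ (Fin k)) :=
    congrArg (mfderiv (𝓡 k) I ψ p) (coordField_self p j)
  let dY : E := mfderiv (𝓡 k) 𝓘(ℝ, E) (fun p' => (mfderiv I 𝓘(ℝ, E) (extChartAt I (ψ p)) (ψ p')
    (mfderiv (𝓡 k) I ψ p' (coordField p j p')) : E)) p v
  have hdY : dY = chartHessian I ψ p v (EuclideanSpace.single j 1) :=
    mfderiv_mfderiv_coordField hψ p j v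
  change A.inverse (dY + christoffel g (ψ p) (extChartAt I (ψ p) (ψ p))
    (A (mfderiv (𝓡 k) I ψ p v)) (A X)) = _
  rw [hdY, hA, hX, ContinuousLinearMap.inverse_id]
  rfl

end Submanifold

section MeanCurvature

variable {m : ℕ} {F : Type*} [TopologicalSpace F] [ChartedSpace (EuclideanSpace ℝ (Fin m)) F]
  {k : ℕ} {M : Type*} [TopologicalSpace M] [ChartedSpace (EuclideanSpace ℝ (Fin k)) M]
  {ψ : M → ℝ × F} {p : M}

theorem contMDiffAt_height {n : ℕ∞ω} (hψ : ContMDiffAt (𝓡 k) (model m) n ψ p) :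
    ContMDiffAt (𝓡 k) 𝓘(ℝ, ℝ) n (height ψ) p :=
  contMDiffAt_fst.comp p hψ

theorem fst_mfderiv (hψ : MDifferentiableAt (𝓡 k) (model m) ψ p) (v : TangentSpace (𝓡 k) p) :
    (mfderiv (𝓡 k) (model m) ψ p v).1 = mfderiv (𝓡 k) 𝓘(ℝ, ℝ) (height ψ) p v := by
  have hcomp := (hasMFDerivAt_fst (I := 𝓘(ℝ, ℝ)) (I' := 𝓡 m) (ψ p)).comp p hψ.hasMFDerivAt
  exact (DFunLike.congr_fun hcomp.mfderiv v).symm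

theorem fst_chartHessian (hψ : ContMDiffAt (𝓡 k) (model m) 2 ψ p) (v w : EuclideanSpace ℝ (Fin k)) :
    (chartHessian (model m) ψ p v w).1 = chartHessian 𝓘(ℝ, ℝ) (height ψ) p v w := by
  have hfst : writtenInExtChartAt (𝓡 k) 𝓘(ℝ, ℝ) p (height ψ) =
      ContinuousLinearMap.fst ℝ ℝ (EuclideanSpace ℝ (Fin m)) ∘
        writtenInExtChartAt (𝓡 k) (model m) p ψ := by
    rw [writtenInExtChartAt_real, writtenInExtChartAt, extChartAt_model]
    rfl
  rw [chartHessian, chartHessian, hfst,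
    fderiv_fderiv_clm_comp _ (contDiffAt_writtenInExtChartAt hψ)]
  rfl

variable [IsManifold (𝓡 m) ∞ F] {f : ℝ → ℝ}
  {gF : Bundle.ContMDiffRiemannianMetric (𝓡 m) ∞ (EuclideanSpace ℝ (Fin m))
    (fun x : F => TangentSpace (𝓡 m) x)}

theorem inducedMetric_metric_of_critical (hψ : MDifferentiableAt (𝓡 k) (model m) ψ p)
    (hcrit : mfderiv (𝓡 k) 𝓘(ℝ, ℝ) (height ψ) p = 0) (v w : TangentSpace (𝓡 k) p) :
    inducedMetric k (metric f gF) ψ p v w = f (ψ p).1 ^ 2 * gF.inner (ψ p).2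
      (mfderiv (𝓡 k) (model m) ψ p v).2 (mfderiv (𝓡 k) (model m) ψ p w).2 := by
  have htime : (mfderiv (𝓡 k) (model m) ψ p v).1 = 0 := by
    rw [fst_mfderiv hψ, hcrit]
    rfl
  refine (metric_apply (ψ p) (mfderiv (𝓡 k) (model m) ψ p v)
    (mfderiv (𝓡 k) (model m) ψ p w)).trans ?_
  rw [htime, zero_mul, sub_zero]

theorem metric_mfderiv_partialT_of_critical (hψ : MDifferentiableAt (𝓡 k) (model m) ψ p)
    (hcrit : mfderiv (𝓡 k) 𝓘(ℝ, ℝ) (height ψ) p = 0) (v : TangentSpace (𝓡 k) p) :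
    metric f gF (ψ p) (mfderiv (𝓡 k) (model m) ψ p v) (partialT (ψ p)) = 0 := by
  rw [metric_apply_partialT, fst_mfderiv hψ, hcrit]
  exact neg_zero

variable [IsManifold (𝓡 k) 1 M]

theorem metric_secondFundamentalForm_partialT_of_critical (hψ : ContMDiff (𝓡 k) (model m) 2 ψ)
    (hcrit : mfderiv (𝓡 k) 𝓘(ℝ, ℝ) (height ψ) p = 0)
    (hf : DifferentiableAt ℝ f (height ψ p)) (hf₀ : f (height ψ p) ≠ 0) (i j : Fin k) :
    metric f gF (ψ p)
        (secondFundamentalForm (metric f gF) ψ (coordField p i) (coordField p j) p)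
        (partialT (ψ p)) =
      chartHessian 𝓘(ℝ, ℝ) (height ψ) p (EuclideanSpace.single i 1) (EuclideanSpace.single j 1) +
        deriv f (height ψ p) / f (height ψ p) * gram k (metric f gF) ψ p i j := by
  have hψp := hψ.mdifferentiableAt two_ne_zero (x := p)
  let C : ℝ × EuclideanSpace ℝ (Fin m) := covDerivAlong (metric f gF) ψ
    (fun p' => mfderiv (𝓡 k) (model m) ψ p' (coordField p j p')) p (coordField p i p)
  have hnormal : metric f gF (ψ p)
      (secondFundamentalForm (metric f gF) ψ (coordField p i) (coordField p j) p)
      (partialT (ψ p)) = C.1 := by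
    have hneg := DFunLike.congr_fun (map_neg (metric f gF (ψ p))
      (normalPart k (metric f gF) ψ p C)) (partialT (ψ p))
    refine hneg.trans ?_
    rw [neg_apply, metric_normalPart_of_orthogonal
      (metric_mfderiv_partialT_of_critical hψp hcrit), metric_apply_partialT]
    exact neg_neg _
  let A : EuclideanSpace ℝ (Fin k) →L[ℝ] ℝ × EuclideanSpace ℝ (Fin m) :=
    mfderiv (𝓡 k) (model m) ψ p
  have hC : C = chartHessian (model m) ψ p (EuclideanSpace.single i 1) (EuclideanSpace.single j 1) +
      christoffel (metric f gF) (ψ p) (extChartAt (model m) (ψ p) (ψ p))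
        (A (EuclideanSpace.single i 1)) (A (EuclideanSpace.single j 1)) := by
    rw [← coordField_self p i]
    exact covDerivAlong_coordField (metric f gF) hψ p (coordField p i p) j
  have hgram : gram k (metric f gF) ψ p i j = f (ψ p).1 ^ 2 * gF.inner (ψ p).2
      (A (EuclideanSpace.single i 1)).2 (A (EuclideanSpace.single j 1)).2 :=
    (gram_apply (metric f gF) ψ p i j).trans (inducedMetric_metric_of_critical hψp hcrit _ _)
  rw [hnormal, hC, Prod.fst_add, fst_chartHessian (hψ p), christoffel_metric_fst hf hf₀, hgram]
  simp only [height] at hf₀ ⊢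
  field_simp

theorem metric_meanCurvature_partialT_of_critical (hk : 1 ≤ k) (hψ : ContMDiff (𝓡 k) (model m) 2 ψ)
    (hcrit : mfderiv (𝓡 k) 𝓘(ℝ, ℝ) (height ψ) p = 0)
    (hf : DifferentiableAt ℝ f (height ψ p)) (hf₀ : f (height ψ p) ≠ 0)
    (hg : (gram k (metric f gF) ψ p).PosDef) :
    metric f gF (ψ p) (meanCurvature k (metric f gF) ψ p) (partialT (ψ p)) =
      (1 / (k : ℝ)) * (∑ i, ∑ j, (gram k (metric f gF) ψ p)⁻¹ i j *
        chartHessian 𝓘(ℝ, ℝ) (height ψ) p (EuclideanSpace.single i 1) (EuclideanSpace.single j 1)) +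
      deriv f (height ψ p) / f (height ψ p) := by
  have hk₀ : (k : ℝ) ≠ 0 := by positivity
  have htrace : ∑ i, ∑ j, (gram k (metric f gF) ψ p)⁻¹ i j *
      (deriv f (height ψ p) / f (height ψ p) * gram k (metric f gF) ψ p i j) =
      deriv f (height ψ p) / f (height ψ p) * k := by
    simp only [mul_left_comm _ (deriv f (height ψ p) / f (height ψ p)), ← Finset.mul_sum,
      sum_inv_mul_self hg, Fintype.card_fin]
  simp only [apply_meanCurvature, mul_add, Finset.sum_add_distrib, htrace,
    metric_secondFundamentalForm_partialT_of_critical hψ hcrit hf hf₀]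
  field_simp

theorem le_metric_meanCurvature_of_isLocalMin (hk : 1 ≤ k) (hψ : ContMDiff (𝓡 k) (model m) 2 ψ)
    (h : IsLocalMin (height ψ) p)
    (hf : DifferentiableAt ℝ f (height ψ p)) (hf₀ : f (height ψ p) ≠ 0)
    (hg : ∀ v : TangentSpace (𝓡 k) p, v ≠ 0 → 0 < inducedMetric k (metric f gF) ψ p v v) :
    deriv f (height ψ p) / f (height ψ p) ≤
      metric f gF (ψ p) (meanCurvature k (metric f gF) ψ p) (partialT (ψ p)) := by
  have hgram := posDef_gram (metric_comm (ψ p)) hg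
  rw [metric_meanCurvature_partialT_of_critical hk hψ (mfderiv_eq_zero_of_isLocalMin h) hf
    hf₀ hgram]
  have htrace := sum_mul_bilin_nonneg (B := (chartHessian 𝓘(ℝ, ℝ) (height ψ) p).toBilinForm)
    (chartHessian_nonneg_of_isLocalMin (contMDiffAt_height (hψ p)) h) hgram.inv.posSemidef
    (fun i => EuclideanSpace.single i 1)
  exact le_add_of_nonneg_left (mul_nonneg (by positivity) htrace)

theorem metric_meanCurvature_le_of_isLocalMax (hk : 1 ≤ k) (hψ : ContMDiff (𝓡 k) (model m) 2 ψ)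
    (h : IsLocalMax (height ψ) p)
    (hf : DifferentiableAt ℝ f (height ψ p)) (hf₀ : f (height ψ p) ≠ 0)
    (hg : ∀ v : TangentSpace (𝓡 k) p, v ≠ 0 → 0 < inducedMetric k (metric f gF) ψ p v v) :
    metric f gF (ψ p) (meanCurvature k (metric f gF) ψ p) (partialT (ψ p)) ≤
      deriv f (height ψ p) / f (height ψ p) := by
  have hgram := posDef_gram (metric_comm (ψ p)) hg
  rw [metric_meanCurvature_partialT_of_critical hk hψ (mfderiv_eq_zero_of_isLocalMax h) hf
    hf₀ hgram]
  have htrace := sum_mul_bilin_nonneg (B := -(chartHessian 𝓘(ℝ, ℝ) (height ψ) p).toBilinForm)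
    (fun v => neg_nonneg.2 (chartHessian_nonpos_of_isLocalMax (contMDiffAt_height (hψ p)) h v))
    hgram.inv.posSemidef (fun i => EuclideanSpace.single i 1)
  simp only [LinearMap.neg_apply, mul_neg, Finset.sum_neg_distrib, neg_nonneg] at htrace
  exact add_le_of_nonpos_left (mul_nonpos_of_nonneg_of_nonpos (by positivity) htrace)

end MeanCurvature

end GRW

end

theorem theorem4p1_general {m : ℕ}
    {F : Type*} [TopologicalSpace F] [ChartedSpace (EuclideanSpace ℝ (Fin m)) F]
    [IsManifold (𝓡 m) ∞ F]
    (gF : Bundle.ContMDiffRiemannianMetric (𝓡 m) ∞ (EuclideanSpace ℝ (Fin m))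
      (fun x : F => TangentSpace (𝓡 m) x))
    (J : Set ℝ) (f : ℝ → ℝ) (hf : ∀ t ∈ J, DifferentiableAt ℝ f t) (hfpos : ∀ t ∈ J, 0 < f t)
    {k : ℕ} (hk : 1 ≤ k)
    {M : Type*} [TopologicalSpace M] [ChartedSpace (EuclideanSpace ℝ (Fin k)) M]
    [IsManifold (𝓡 k) 2 M]
    (ψ : M → ℝ × F) (hψJ : ∀ p, GRW.height ψ p ∈ J) (hψ : ContMDiff (𝓡 k) (GRW.model m) 2 ψ)
    (hg : ∀ (p : M) (v : TangentSpace (𝓡 k) p), v ≠ 0 →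
      0 < GRW.inducedMetric k (GRW.metric f gF) ψ p v v) :
    (((∀ p, GRW.metric f gF (ψ p) (GRW.meanCurvature k (GRW.metric f gF) ψ p)
            (GRW.partialT (ψ p)) < 0) →
        (∀ t ∈ J, 0 ≤ deriv f t) → ∀ p, ¬ IsLocalMin (GRW.height ψ) p) ∧
      ((∀ p, GRW.metric f gF (ψ p) (GRW.meanCurvature k (GRW.metric f gF) ψ p)
            (GRW.partialT (ψ p)) ≤ 0) →
        (∀ t ∈ J, 0 < deriv f t) → ∀ p, ¬ IsLocalMin (GRW.height ψ) p)) ∧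
    (((∀ p, 0 < GRW.metric f gF (ψ p) (GRW.meanCurvature k (GRW.metric f gF) ψ p)
            (GRW.partialT (ψ p))) →
        (∀ t ∈ J, deriv f t ≤ 0) → ∀ p, ¬ IsLocalMax (GRW.height ψ) p) ∧
      ((∀ p, 0 ≤ GRW.metric f gF (ψ p) (GRW.meanCurvature k (GRW.metric f gF) ψ p)
            (GRW.partialT (ψ p))) →
        (∀ t ∈ J, deriv f t < 0) → ∀ p, ¬ IsLocalMax (GRW.height ψ) p)) := by
  have hpos (p : M) : 0 < f (GRW.height ψ p) := hfpos _ (hψJ p)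
  have hmin {p : M} (h : IsLocalMin (GRW.height ψ) p) :=
    GRW.le_metric_meanCurvature_of_isLocalMin hk hψ h (hf _ (hψJ p)) (hpos p).ne' (hg p)
  have hmax {p : M} (h : IsLocalMax (GRW.height ψ) p) :=
    GRW.metric_meanCurvature_le_of_isLocalMax hk hψ h (hf _ (hψJ p)) (hpos p).ne' (hg p)
  refine ⟨⟨fun hH hd p h => ?_, fun hH hd p h => ?_⟩, fun hH hd p h => ?_, fun hH hd p h => ?_⟩
  · exact ((hmin h).trans_lt (hH p)).not_ge (div_nonneg (hd _ (hψJ p)) (hpos p).le)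
  · exact ((hmin h).trans (hH p)).not_gt (div_pos (hd _ (hψJ p)) (hpos p))
  · exact ((hH p).trans_le (hmax h)).not_ge
      (div_nonpos_of_nonpos_of_nonneg (hd _ (hψJ p)) (hpos p).le)
  · exact ((hH p).trans (hmax h)).not_gt (div_neg_of_neg_of_pos (hd _ (hψJ p)) (hpos p))

open scoped Manifold ContDiff in
theorem theorem4p1
    -- the fiber: a connected Riemannian manifold of dimension `m = n - 1 ≥ 2`
    {m : ℕ} (hm : 2 ≤ m)
    {F : Type*} [TopologicalSpace F] [T2Space F] [SecondCountableTopology F] [ConnectedSpace F]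
    [ChartedSpace (EuclideanSpace ℝ (Fin m)) F] [IsManifold (𝓡 m) ∞ F]
    (gF : Bundle.ContMDiffRiemannianMetric (𝓡 m) ∞ (EuclideanSpace ℝ (Fin m))
      (fun x : F => TangentSpace (𝓡 m) x))
    -- the open interval and the warping function
    (J : Set ℝ) (hJo : IsOpen J) (hJc : J.OrdConnected)
    (f : ℝ → ℝ) (hf : ContDiffOn ℝ ∞ f J) (hfpos : ∀ t ∈ J, 0 < f t)
    -- the connected spacelike submanifold, of dimension `k ≥ 1`
    {k : ℕ} (hk : 1 ≤ k)
    {M : Type*} [TopologicalSpace M] [T2Space M] [SecondCountableTopology M] [ConnectedSpace M]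
    [ChartedSpace (EuclideanSpace ℝ (Fin k)) M] [IsManifold (𝓡 k) ∞ M]
    (ψ : M → ℝ × F) (hψ : GRW.IsSpacelikeImmersion k J f gF ψ) :
    (((∀ p, GRW.metric f gF (ψ p) (GRW.meanCurvature k (GRW.metric f gF) ψ p) (GRW.partialT (ψ p)) < 0) →
        (∀ t ∈ J, 0 ≤ deriv f t) → ∀ p, ¬ IsLocalMin (GRW.height ψ) p) ∧
      ((∀ p, GRW.metric f gF (ψ p) (GRW.meanCurvature k (GRW.metric f gF) ψ p) (GRW.partialT (ψ p)) ≤ 0) →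
        (∀ t ∈ J, 0 < deriv f t) → ∀ p, ¬ IsLocalMin (GRW.height ψ) p)) ∧
    (((∀ p, 0 < GRW.metric f gF (ψ p) (GRW.meanCurvature k (GRW.metric f gF) ψ p) (GRW.partialT (ψ p))) →
        (∀ t ∈ J, deriv f t ≤ 0) → ∀ p, ¬ IsLocalMax (GRW.height ψ) p) ∧
      ((∀ p, 0 ≤ GRW.metric f gF (ψ p) (GRW.meanCurvature k (GRW.metric f gF) ψ p) (GRW.partialT (ψ p))) →
        (∀ t ∈ J, deriv f t < 0) → ∀ p, ¬ IsLocalMax (GRW.height ψ) p)) := by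
  exact theorem4p1_general gF J f
    (fun t ht => (hf.contDiffAt (hJo.mem_nhds ht)).differentiableAt (by simp)) hfpos hk ψ hψ.mem
    (hψ.contMDiff.of_le (WithTop.coe_le_coe.2 le_top)) hψ.posDef
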